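/- Let $\Omega\subset\mathbb R^2$ be a bounded polygonal domain, $0<T<\infty$, and let $A=(a_{ij})_{1\le i,j\le 2}$ be a symmetric, uniformly positive definite matrix field on $\Omega$ whose entries are smooth with uniformly bounded derivatives (including the entries themselves). Write $(\cdot,\cdot)$ for the inner product of $L^2(\Omega)$ or $L^2(\Omega)^2$, $W=L^2(\Omega)$, $V=H(\mathrm{div},\Omega)=\{v\in L^2(\Omega)^2:\nabla\cdot v\in L^2(\Omega)\}$ with the graph norm, $H^1_0=H^1_0(\Omega)$, $H^{-1}=(H^1_0)^*$ with duality pairing $\langle\cdot,\cdot\rangle$, and $L^2(X)=L^2(0,T;X)$. Let $f\in L^2(W)$ and $u_0,u_1\in W$. *Primal formulation.* $u$ is a weak primal solution if $u\in L^2(H^1_0)$, $u_t\in L^2(W)$, $u_{tt}\in L^2(H^{-1})$ (weak time derivatives), $u(0)=u_0$ in $W$, $u_t(0)=u_1$ in $H^{-1}$ (in the sense of the continuous representatives on $[0,T]$), and for almost every $t\in(0,T)$ $$\langle u_{tt},w\rangle+(A\nabla u,\nabla w)=(f,w)\qquad\forall\,w\in H^1_0 .$$ *Mixed formulation.* $(u,\sigma)$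 is a weak mixed solution if $u,u_t\in L^2(W)$, $u_{tt}\in L^2(H^{-1})$, $\sigma\in L^2(V)$, $u(0)=u_0$ in $W$, $u_t(0)=u_1$ in $H^{-1}$ (same sense), and for almost every $t\in(0,T)$ $$(A^{-1}\sigma,v)-(u,\nabla\cdot v)=0\quad\forall\,v\in V,\qquad \langle u_{tt},w\rangle+(\nabla\cdot\sigma,w)=(f,w)\quad\forall\,w\in W,$$ where in the last equation the functional $u_{tt}(t)\in H^{-1}$ is required to extend continuously to $W$, and $\langle u_{tt},w\rangle$ denotes the value of this (unique) extension. **Theorem.** Let $(u,\sigma)\in L^2(W)\times L^2(V)$. Then $(u,\sigma)$ is a weak mixed solution if and only if $u_0\in H^1_0$, $u\in L^2(H^1_0)$ is a weak primal solution, and $\sigma=-A\nabla u$ almost everywhere in $\Omega\times(0,T)$. -/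

import Mathlib

open MeasureTheory TopologicalSpace Set
open scoped ContDiff Gradient Distributions Matrix

noncomputable section

namespace MixedWave

/-- The Euclidean plane. -/
abbrev Plane : Type := EuclideanSpace ℝ (Fin 2)

/-- `Ω` is a bounded polygonal domain: a nonempty, connected, bounded open subset of the plane whose
boundary is a union of finitely many straight line segments. -/
def IsPolygonalDomain (Ω : Opens Plane) : Prop :=
  IsConnected (Ω : Set Plane) ∧ Bornology.IsBounded (Ω : Set Plane) ∧
    ∃ E : Finset (Plane × Plane), frontier (Ω : Set Plane) = ⋃ e ∈ E, segment ℝ e.1 e.2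

/-! ### The coefficient matrix -/

/-- The matrix `M` applied to the vector `ξ`. -/
def mulVec (M : Matrix (Fin 2) (Fin 2) ℝ) (ξ : Plane) : Plane := WithLp.toLp 2 (M *ᵥ ξ.ofLp)

/-- `A` is a symmetric, uniformly positive definite matrix field on `Ω` whose entries are smooth
with bounded derivatives of every order (order `0` included). -/
structure IsCoefficient (Ω : Opens Plane) (A : Plane → Matrix (Fin 2) (Fin 2) ℝ) : Prop where
  symm : ∀ x ∈ Ω, (A x).IsSymm
  posDef : ∃ a : ℝ, 0 < a ∧ ∀ x ∈ Ω, ∀ ξ : Plane, a * ‖ξ‖ ^ 2 ≤ inner ℝ (mulVec (A x) ξ) ξ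
  smooth : ∀ i j, ContDiffOn ℝ ∞ (fun x => A x i j) (Ω : Set Plane)
  bounded : ∀ i j, ∀ k : ℕ, ∃ C : ℝ, ∀ x ∈ Ω,
    ‖iteratedFDerivWithin ℝ k (fun x => A x i j) (Ω : Set Plane) x‖ ≤ C

/-! ### Function spaces on `Ω` -/

/-- `L²(Ω)`. -/
abbrev L2 (Ω : Opens Plane) : Type := Lp ℝ 2 (volume.restrict (Ω : Set Plane))

/-- `L²(Ω)²`. -/
abbrev L2vec (Ω : Opens Plane) : Type := Lp Plane 2 (volume.restrict (Ω : Set Plane))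

lemma memLp_testFunction {Ω : Opens Plane} (φ : 𝓓(Ω, ℝ)) :
    MemLp (φ : Plane → ℝ) 2 (volume.restrict (Ω : Set Plane)) :=
  (φ.continuous.memLp_of_hasCompactSupport φ.hasCompactSupport).restrict _

lemma memLp_gradient_testFunction {Ω : Opens Plane} (φ : 𝓓(Ω, ℝ)) :
    MemLp (∇ (φ : Plane → ℝ)) 2 (volume.restrict (Ω : Set Plane)) := by
  have hd : Continuous (fderiv ℝ (φ : Plane → ℝ)) := φ.contDiff.continuous_fderiv (by simp)
  have hc : Continuous (∇ (φ : Plane → ℝ)) :=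
    (InnerProductSpace.toDual ℝ Plane).symm.continuous.comp hd
  have hs : HasCompactSupport (∇ (φ : Plane → ℝ)) :=
    (φ.hasCompactSupport.fderiv (𝕜 := ℝ)).comp_left
      (g := (InnerProductSpace.toDual ℝ Plane).symm) (map_zero _)
  exact (hc.memLp_of_hasCompactSupport hs).restrict _

/-- A test function as an element of `L²(Ω)`. -/
def testL2 {Ω : Opens Plane} (φ : 𝓓(Ω, ℝ)) : L2 Ω := (memLp_testFunction φ).toLp _

/-- The gradient of a test function as an element of `L²(Ω)²`. -/
def testGrad {Ω : Opens Plane} (φ : 𝓓(Ω, ℝ)) : L2vec Ω := (memLp_gradient_testFunction φ).toLp _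

/-- `H¹₀(Ω)`: the completion of `C_c^∞(Ω)` in the `H¹` norm, realized as the closure in
`L²(Ω) × L²(Ω)²`, with norm `(‖w‖² + ‖∇w‖²)^(1/2)`, of the pairs `(φ, ∇φ)` with `φ ∈ C_c^∞(Ω)`.
(These pairs already form a linear subspace.) An element is thus a function together with its weak
gradient. -/
def H10 (Ω : Opens Plane) : Submodule ℝ (WithLp 2 (L2 Ω × L2vec Ω)) :=
  (Submodule.span ℝ (range fun φ : 𝓓(Ω, ℝ) =>
    WithLp.toLp 2 (testL2 φ, testGrad φ))).topologicalClosure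

/-- The inclusion of `H¹₀(Ω)` in `L²(Ω)`. -/
def H10.fn (Ω : Opens Plane) : H10 Ω →L[ℝ] L2 Ω :=
  (WithLp.fstL 2 ℝ (L2 Ω) (L2vec Ω)).comp (H10 Ω).subtypeL

/-- The weak gradient of an element of `H¹₀(Ω)`. -/
def H10.grad (Ω : Opens Plane) : H10 Ω →L[ℝ] L2vec Ω :=
  (WithLp.sndL 2 ℝ (L2 Ω) (L2vec Ω)).comp (H10 Ω).subtypeL

/-- `H⁻¹(Ω)`, the dual space of `H¹₀(Ω)`. -/
abbrev Hneg1 (Ω : Opens Plane) : Type := StrongDual ℝ (H10 Ω)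

/-- The embedding of `L²(Ω)` in `H⁻¹(Ω)`, `g ↦ (w ↦ (g, w))`. -/
def toHneg1 {Ω : Opens Plane} (g : L2 Ω) : Hneg1 Ω := (innerSL ℝ g).comp (H10.fn Ω)

/-- `H(div, Ω)`: the fields `v ∈ L²(Ω)²` with weak divergence `d ∈ L²(Ω)`, i.e.
`(v, ∇φ) = -(d, φ)` for all `φ ∈ C_c^∞(Ω)`. An element is stored as the pair `(v, d)`, in which `v`
determines `d`; the norm is `(‖v‖² + ‖d‖²)^(1/2)`. -/
def Hdiv (Ω : Opens Plane) : Submodule ℝ (WithLp 2 (L2vec Ω × L2 Ω)) where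
  carrier := {p | ∀ φ : 𝓓(Ω, ℝ), inner ℝ p.fst (testGrad φ) = - inner ℝ p.snd (testL2 φ)}
  add_mem' {p q} hp hq φ := by
    simp only [WithLp.add_fst, WithLp.add_snd, inner_add_left, hp φ, hq φ]
    ring
  zero_mem' φ := by simp
  smul_mem' c p hp φ := by
    simp only [WithLp.smul_fst, WithLp.smul_snd, real_inner_smul_left, hp φ]
    ring

/-- The inclusion of `H(div, Ω)` in `L²(Ω)²`. -/
def Hdiv.fn (Ω : Opens Plane) : Hdiv Ω →L[ℝ] L2vec Ω :=
  (WithLp.fstL 2 ℝ (L2vec Ω) (L2 Ω)).comp (Hdiv Ω).subtypeL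

/-- The weak divergence of an element of `H(div, Ω)`. -/
def Hdiv.div (Ω : Opens Plane) : Hdiv Ω →L[ℝ] L2 Ω :=
  (WithLp.sndL 2 ℝ (L2vec Ω) (L2 Ω)).comp (Hdiv Ω).subtypeL

/-- The weighted `L²` product `(M p, q) = ∫_Ω M(x) p(x) · q(x) dx`. -/
def weightedInner {Ω : Opens Plane} (M : Plane → Matrix (Fin 2) (Fin 2) ℝ) (p q : L2vec Ω) : ℝ :=
  ∫ x in (Ω : Set Plane), inner ℝ (mulVec (M x) (p x)) (q x)

/-! ### Functions of time with values in a Banach space -/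

/-- `u ∈ L²(0, T; X)`. -/
def L2Time {X : Type*} [NormedAddCommGroup X] (T : ℝ) (u : ℝ → X) : Prop :=
  MemLp u 2 (volume.restrict (Ioo 0 T))

/-- `g` is the weak derivative of `u` on `(0, T)`:
`∫ φ'(t) u(t) dt = - ∫ φ(t) g(t) dt` in `X` for all `φ ∈ C_c^∞(0, T)`. -/
def IsWeakTimeDeriv {X : Type*} [NormedAddCommGroup X] [NormedSpace ℝ X]
    (T : ℝ) (u g : ℝ → X) : Prop :=
  ∀ φ : ℝ → ℝ, ContDiff ℝ ∞ φ → HasCompactSupport φ → tsupport φ ⊆ Ioo 0 T →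
    ∫ t in Ioo 0 T, deriv φ t • u t = - ∫ t in Ioo 0 T, φ t • g t

/-- `u(0) = x`: `u` agrees almost everywhere on `(0, T)` with a continuous function
`[0, T] → X` whose value at `0` is `x`. -/
def HasInitialValue {X : Type*} [NormedAddCommGroup X] (T : ℝ) (u : ℝ → X) (x : X) : Prop :=
  ∃ v : ℝ → X, ContinuousOn v (Icc 0 T) ∧ (∀ᵐ t ∂volume.restrict (Ioo 0 T), u t = v t) ∧ v 0 = x

/-- `u, u_t ∈ L²(0, T; L²(Ω))`, `u_tt ∈ L²(0, T; H⁻¹(Ω))`, `u(0) = u₀` in `L²(Ω)` and `u_t(0) = u₁`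
in `H⁻¹(Ω)`, where `ut` and `utt` are the weak time derivatives. -/
structure HasTimeRegularity {Ω : Opens Plane} (T : ℝ) (u₀ u₁ : L2 Ω) (u ut : ℝ → L2 Ω)
    (utt : ℝ → Hneg1 Ω) : Prop where
  memL2_u : L2Time T u
  memL2_ut : L2Time T ut
  memL2_utt : L2Time T utt
  deriv_u : IsWeakTimeDeriv T u ut
  deriv_ut : IsWeakTimeDeriv T (fun t => toHneg1 (ut t)) utt
  initial_u : HasInitialValue T u u₀
  initial_ut : HasInitialValue T (fun t => toHneg1 (ut t)) (toHneg1 u₁)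

/-! ### The two weak formulations -/

/-- `u` is a solution of the weak primal formulation with data `f, u₀, u₁`:
`⟨u_tt, w⟩ + (A ∇u, ∇w) = (f, w)` for all `w ∈ H¹₀(Ω)` and almost every `t ∈ (0, T)`. -/
def IsPrimalSolution {Ω : Opens Plane} (T : ℝ) (A : Plane → Matrix (Fin 2) (Fin 2) ℝ)
    (f : ℝ → L2 Ω) (u₀ u₁ : L2 Ω) (u : ℝ → H10 Ω) : Prop :=
  L2Time T u ∧ ∃ (ut : ℝ → L2 Ω) (utt : ℝ → Hneg1 Ω),
    HasTimeRegularity T u₀ u₁ (fun t => H10.fn Ω (u t)) ut utt ∧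
    ∀ᵐ t ∂volume.restrict (Ioo 0 T), ∀ w : H10 Ω,
      utt t w + weightedInner A (H10.grad Ω (u t)) (H10.grad Ω w) = inner ℝ (f t) (H10.fn Ω w)

/-- `(u, σ)` is a solution of the weak mixed formulation with data `f, u₀, u₁`:
for almost every `t ∈ (0, T)`, `(A⁻¹σ, v) - (u, div v) = 0` for all `v ∈ H(div, Ω)` and
`⟨u_tt, w⟩ + (div σ, w) = (f, w)` for all `w ∈ L²(Ω)`. For `w ∈ L²(Ω)` the pairing `⟨u_tt, w⟩` is
read through the (unique, by density) continuous extension `ℓ` of `u_tt(t)` to `L²(Ω)`, whose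
existence is part of the requirement. -/
def IsMixedSolution {Ω : Opens Plane} (T : ℝ) (A : Plane → Matrix (Fin 2) (Fin 2) ℝ)
    (f : ℝ → L2 Ω) (u₀ u₁ : L2 Ω) (u : ℝ → L2 Ω) (σ : ℝ → Hdiv Ω) : Prop :=
  L2Time T σ ∧ ∃ (ut : ℝ → L2 Ω) (utt : ℝ → Hneg1 Ω),
    HasTimeRegularity T u₀ u₁ u ut utt ∧
    (∀ᵐ t ∂volume.restrict (Ioo 0 T), ∀ v : Hdiv Ω,
      weightedInner (fun x => (A x)⁻¹) (Hdiv.fn Ω (σ t)) (Hdiv.fn Ω v)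
        - inner ℝ (u t) (Hdiv.div Ω v) = 0) ∧
    (∀ᵐ t ∂volume.restrict (Ioo 0 T), ∃ ℓ : StrongDual ℝ (L2 Ω),
      (∀ z : H10 Ω, ℓ (H10.fn Ω z) = utt t z) ∧
      ∀ w : L2 Ω, ℓ w + inner ℝ (Hdiv.div Ω (σ t)) w = inner ℝ (f t) w)

end MixedWave

end

namespace MixedWave

/-! ### Functions of time -/

/-! Inside `L²(Ω) × L²(Ω)²`, the orthogonal complement of `H10 Ω` is `Hdiv Ω` with its components
swapped: this is the definition of the weak divergence (`mem_H10_orthogonal_iff`). As `H10 Ω` is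
closed, the flux equation at time `t` says exactly that `u(t) ∈ H¹₀` with `∇u(t) = -A⁻¹σ(t)`; the
boundary condition comes without traces. Green's formula then turns one wave equation into the
other, the extension of `u_tt(t)` to `L²` being `f(t) - ∇·σ(t)`.

The delicate point is `u₀ ∈ H¹₀`, since `u₀` is only an `L²` limit of `u(t)`. Formally `d/dt (A⁻¹σ,
σ) = 2 (u_t, ∇·σ)` is integrable, but `σ` has no time derivative. Finite differences replace it: by
the flux equation and the symmetry of `A`, `(u(t), ∇·σ(s))` is symmetric in `t, s`, so the energy
`E(t) = (u(t), ∇·σ(t)) = (A⁻¹σ(t), σ(t))` satisfies `E(t+h) - E(t) = (u(t+h) - u(t), ∇·σ(t+h) +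
∇·σ(t))`. Averaging in time bounds `E` along some times tending to `0`
(`exists_initial_energy_bound`). Hence `|(u₀, ∇·v)| ≤ C‖v‖` for all `v ∈ H(div)`, and Hahn–Banach
with Riesz gives `u₀` a weak gradient (`exists_H10_of_bound`). -/

lemma integral_sliding_sub {F : ℝ → ℝ} (hF : ∀ a b, IntervalIntegrable F volume a b) (b h : ℝ) :
    ∫ t in (0:ℝ)..b, (F (t + h) - F t) = (∫ t in b..(b + h), F t) - ∫ t in (0:ℝ)..h, F t := by
  have h1 : IntervalIntegrable (fun t => F (t + h)) volume 0 b := by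
    simpa using (hF (0 + h) (b + h)).comp_add_right h
  rw [intervalIntegral.integral_sub h1 (hF _ _), intervalIntegral.integral_comp_add_right]
  have h2 := intervalIntegral.integral_add_adjacent_intervals (hF 0 b) (hF b (b + h))
  have h3 := intervalIntegral.integral_add_adjacent_intervals (hF 0 h) (hF h (b + h))
  rw [zero_add]
  linarith

/-- Each `s` lies in the windows `[t, t + h]` only for a set of `t` of length `h`. In terms of the
primitive `F`, the double integral is `∫ F` over `(b, b + h)`, where `F ≤ ∫ g`, minus `∫ F` over
`(0, h)`, where `F ≥ 0`. -/
lemma integral_sliding_integral_le {g : ℝ → ℝ} (hg : Integrable g) (h0 : ∀ t, 0 ≤ g t) {b h : ℝ}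
    (hb : 0 ≤ b) (hh : 0 ≤ h) :
    ∫ t in (0:ℝ)..b, ∫ s in t..(t + h), g s ≤ h * ∫ t, g t := by
  set F : ℝ → ℝ := fun t => ∫ s in (0:ℝ)..t, g s with hFdef
  have hc : Continuous F := intervalIntegral.continuous_primitive (fun _ _ => hg.intervalIntegrable) 0
  have e1 : ∀ t, ∫ s in t..(t + h), g s = F (t + h) - F t := fun t =>
    (intervalIntegral.integral_interval_sub_left hg.intervalIntegrable hg.intervalIntegrable).symm
  simp_rw [e1]
  rw [integral_sliding_sub (fun _ _ => hc.intervalIntegrable _ _)]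
  have e2 : ∫ t in b..(b + h), F t ≤ ∫ t in b..(b + h), (∫ t, g t) := by
    refine intervalIntegral.integral_mono_on (by linarith) (hc.intervalIntegrable _ _)
      intervalIntegrable_const fun t ht => ?_
    rw [hFdef]
    simp only
    rw [intervalIntegral.integral_of_le (hb.trans ht.1)]
    exact setIntegral_le_integral hg (ae_of_all _ h0)
  have e3 : 0 ≤ ∫ t in (0:ℝ)..h, F t :=
    intervalIntegral.integral_nonneg hh fun t ht =>
      intervalIntegral.integral_nonneg ht.1 fun s _ => h0 s
  rw [intervalIntegral.integral_const, smul_eq_mul] at e2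
  linarith

/-- If the increments of `E` over steps of length `h` are controlled by integrable quantities, then
the averages of `E` over `(0, h)` are bounded as `h → 0`. -/
lemma exists_initial_average_bound {E G D : ℝ → ℝ} (hE : Integrable E) (hG : Integrable G)
    (hD : Integrable D) (hE0 : ∀ t, 0 ≤ E t) (hG0 : ∀ t, 0 ≤ G t) (hD0 : ∀ t, 0 ≤ D t)
    {c : ℝ} (hc : 0 < c)
    (H : ∀ h ∈ Ioo 0 c, ∀ᵐ t, t ∈ Ioo 0 c →
      E t ≤ E (t + h) + (∫ s in t..(t + h), G s) + h * (D (t + h) + D t)) :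
    ∃ C, ∀ h ∈ Ioo 0 c, ∫ t in (0:ℝ)..h, E t ≤ C * h := by
  set K : ℝ := (∫ t, G t) + 2 * ∫ t, D t with hK
  refine ⟨c⁻¹ * (∫ t, E t) + K, fun h hh => ?_⟩
  have ii : ∀ {f : ℝ → ℝ}, Integrable f → ∀ a b, IntervalIntegrable f volume a b :=
    fun hf _ _ => hf.intervalIntegrable
  have hslide : ∀ {f : ℝ → ℝ}, Integrable f → Continuous fun t => ∫ s in t..(t + h), f s := by
    intro f hf
    have e : (fun t => ∫ s in t..(t + h), f s)
        = fun t => (∫ s in (0:ℝ)..(t + h), f s) - ∫ s in (0:ℝ)..t, f s := by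
      funext t
      exact (intervalIntegral.integral_interval_sub_left (ii hf _ _) (ii hf _ _)).symm
    have hp : Continuous fun t => ∫ s in (0:ℝ)..t, f s :=
      intervalIntegral.continuous_primitive (fun _ _ => ii hf _ _) 0
    rw [e]
    exact (hp.comp (continuous_id.add continuous_const)).sub hp
  have sub_le : ∀ {f : ℝ → ℝ}, Integrable f → (∀ t, 0 ≤ f t) → ∀ a b, a ≤ b →
      ∫ t in a..b, f t ≤ ∫ t, f t := by
    intro f hf h0 a b hab
    rw [intervalIntegral.integral_of_le hab]
    exact setIntegral_le_integral hf (ae_of_all _ h0)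
  -- Integrating the increment bound over `(0, b)` telescopes, leaving one window at `0` and one at
  -- `b`. Averaging over `b ∈ (0, c)` then makes the window at `b` of order `h`.
  have key : ∀ b ∈ Icc 0 c, ∫ t in (0:ℝ)..h, E t ≤ (∫ t in b..(b + h), E t) + h * K := by
    intro b hb
    have h1 : ∫ t in (0:ℝ)..b, (E t - E (t + h)) ≤
        ∫ t in (0:ℝ)..b, ((∫ s in t..(t + h), G s) + h * (D (t + h) + D t)) := by
      refine intervalIntegral.integral_mono_ae_restrict hb.1
        ((ii hE _ _).sub (ii (hE.comp_add_right h) _ _))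
        (((hslide hG).intervalIntegrable _ _).add
          (((ii (hD.comp_add_right h) _ _).add (ii hD _ _)).const_mul h)) ?_
      rw [Filter.EventuallyLE, ← Measure.restrict_congr_set (Ioo_ae_eq_Icc (μ := volume)), ae_restrict_iff' measurableSet_Ioo]
      filter_upwards [H h hh] with t ht htb
      have := ht ⟨htb.1, htb.2.trans_le hb.2⟩
      linarith
    have h2 := integral_sliding_sub (ii hE) b h
    have h3 : ∫ t in (0:ℝ)..b, (E t - E (t + h)) = - ∫ t in (0:ℝ)..b, (E (t + h) - E t) := by
      rw [← intervalIntegral.integral_neg]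
      simp
    have h4 : ∫ t in (0:ℝ)..b, D (t + h) ≤ ∫ t, D t := by
      rw [intervalIntegral.integral_comp_add_right]
      exact sub_le hD hD0 _ _ (by linarith [hb.1])
    have h5 := sub_le hD hD0 0 b hb.1
    have h6 := integral_sliding_integral_le hG hG0 hb.1 hh.1.le
    rw [intervalIntegral.integral_add ((hslide hG).intervalIntegrable _ _)
      (((ii (hD.comp_add_right h) _ _).add (ii hD _ _)).const_mul h),
      intervalIntegral.integral_const_mul,
      intervalIntegral.integral_add (ii (hD.comp_add_right h) _ _) (ii hD _ _)] at h1
    have h7 : h * ((∫ t in (0:ℝ)..b, D (t + h)) + ∫ t in (0:ℝ)..b, D t) ≤ h * (2 * ∫ t, D t) :=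
      mul_le_mul_of_nonneg_left (by linarith) hh.1.le
    have h8 : h * K = h * (∫ t, G t) + h * (2 * ∫ t, D t) := by rw [hK]; ring
    linarith
  have h1 : ∫ _ in (0:ℝ)..c, (∫ t in (0:ℝ)..h, E t) ≤
      ∫ b in (0:ℝ)..c, ((∫ t in b..(b + h), E t) + h * K) :=
    intervalIntegral.integral_mono_on hc.le intervalIntegrable_const
      (((hslide hE).intervalIntegrable _ _).add intervalIntegrable_const) key
  rw [intervalIntegral.integral_add ((hslide hE).intervalIntegrable _ _) intervalIntegrable_const,
    intervalIntegral.integral_const, intervalIntegral.integral_const, smul_eq_mul, smul_eq_mul,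
    sub_zero] at h1
  have h2 := integral_sliding_integral_le hE hE0 hc.le hh.1.le
  have h3 : c * (∫ t in (0:ℝ)..h, E t) ≤ c * ((c⁻¹ * (∫ t, E t) + K) * h) := by
    have : c * ((c⁻¹ * (∫ t, E t) + K) * h) = h * (∫ t, E t) + c * (h * K) := by
      field_simp
    linarith
  exact le_of_mul_le_mul_left h3 hc

/-! ### Increments of a weakly differentiable function -/

section
variable {X : Type*} [NormedAddCommGroup X] [NormedSpace ℝ X] [CompleteSpace X]

/-- Fubini on the strip `s < t ≤ s + h`. -/
lemma integral_window_smul {ψ : ℝ → ℝ} {g : ℝ → X} (hψ : Integrable ψ) (hg : Integrable g)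
    {h : ℝ} (hh : 0 ≤ h) :
    ∫ t, (∫ s in (t - h)..t, ψ s) • g t = ∫ s, ψ s • ∫ t in s..(s + h), g t := by
  set S : Set (ℝ × ℝ) := {p | p.2 < p.1 ∧ p.1 ≤ p.2 + h}
  have hS : MeasurableSet S :=
    (measurableSet_lt measurable_snd measurable_fst).inter
      (measurableSet_le measurable_fst (measurable_snd.add_const h))
  have hint : Integrable (fun p : ℝ × ℝ => S.indicator (fun p => ψ p.2 • g p.1) p)
      (volume.prod volume) := by
    refine Integrable.indicator ?_ hS
    exact (hψ.smul_prod hg).swap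
  have hswap := integral_integral_swap
    (f := fun t s => S.indicator (fun p : ℝ × ℝ => ψ p.2 • g p.1) (t, s)) hint
  have e1 : ∀ t, ∫ s, S.indicator (fun p : ℝ × ℝ => ψ p.2 • g p.1) (t, s)
      = (∫ s in (t - h)..t, ψ s) • g t := by
    intro t
    rw [intervalIntegral.integral_of_le (by linarith), ← integral_Ico_eq_integral_Ioc,
      ← integral_smul_const, ← integral_indicator measurableSet_Ico]
    congr 1
    funext s
    simp only [indicator, S, mem_ofPred_eq, mem_Ico]
    congr 1
    apply propext
    constructor <;> rintro ⟨h1, h2⟩ <;> constructor <;> linarith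
  have e2 : ∀ s, ∫ t, S.indicator (fun p : ℝ × ℝ => ψ p.2 • g p.1) (t, s)
      = ψ s • ∫ t in s..(s + h), g t := by
    intro s
    rw [intervalIntegral.integral_of_le (by linarith), ← integral_smul,
      ← integral_indicator measurableSet_Ioc]
    congr 1
  simp_rw [e1, e2] at hswap
  exact hswap

/-- A function with an integrable weak time derivative is, up to a null set, the integral of it. -/
lemma ae_sub_eq_integral_of_isWeakTimeDeriv {T : ℝ} {u g : ℝ → X} (hu : IntegrableOn u (Ioo 0 T))
    (hg : IntegrableOn g (Ioo 0 T)) (hw : IsWeakTimeDeriv T u g) {h : ℝ} (hh : 0 < h) :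
    ∀ᵐ t, t ∈ Ioo 0 (T - h) → u (t + h) - u t = ∫ s in t..(t + h), g s := by
  set U : ℝ → X := (Ioo 0 T).indicator u with hUdef
  set G : ℝ → X := (Ioo 0 T).indicator g with hGdef
  have hU : Integrable U := hu.integrable_indicator measurableSet_Ioo
  have hG : Integrable G := hg.integrable_indicator measurableSet_Ioo
  have hW : ∀ φ : ℝ → ℝ, ContDiff ℝ ∞ φ → HasCompactSupport φ → tsupport φ ⊆ Ioo 0 T →
      ∫ t, deriv φ t • U t = - ∫ t, φ t • G t := by
    intro φ h1 h2 h3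
    have := hw φ h1 h2 h3
    rw [← integral_indicator measurableSet_Ioo, ← integral_indicator measurableSet_Ioo] at this
    simpa only [hUdef, hGdef, indicator_smul] using this
  have hGc : Continuous fun t => ∫ s in t..(t + h), G s := by
    have e : (fun t => ∫ s in t..(t + h), G s)
        = fun t => (∫ s in (0:ℝ)..(t + h), G s) - ∫ s in (0:ℝ)..t, G s := by
      funext t
      exact (intervalIntegral.integral_interval_sub_left hG.intervalIntegrable
        hG.intervalIntegrable).symm
    have hp : Continuous fun t => ∫ s in (0:ℝ)..t, G s :=
      intervalIntegral.continuous_primitive (fun _ _ => hG.intervalIntegrable) 0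
    rw [e]
    exact (hp.comp (continuous_id.add continuous_const)).sub hp
  have hUh : Integrable fun t => U (t + h) := hU.comp_add_right h
  have main := (isOpen_Ioo (a := (0:ℝ)) (b := T - h)).ae_eq_zero_of_integral_contDiff_smul_eq_zero
    (μ := volume) (f := fun t => U (t + h) - U t - ∫ s in t..(t + h), G s)
    (((hUh.sub hU).locallyIntegrable.sub hGc.locallyIntegrable).locallyIntegrableOn _) ?_
  · filter_upwards [main] with t ht htI
    have hI : uIcc t (t + h) ⊆ Ioo 0 T := by
      rw [uIcc_of_le (by linarith)]
      exact fun s hs => ⟨htI.1.trans_le hs.1, hs.2.trans_lt (by linarith [htI.2])⟩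
    have e1 : U t = u t := indicator_of_mem (hI left_mem_uIcc) _
    have e2 : U (t + h) = u (t + h) := indicator_of_mem (hI right_mem_uIcc) _
    have e3 : ∫ s in t..(t + h), G s = ∫ s in t..(t + h), g s :=
      intervalIntegral.integral_congr fun s hs => indicator_of_mem (hI hs) _
    rw [← e1, ← e2, ← e3]
    exact sub_eq_zero.1 (ht htI)
  · intro ψ hψ hψc hψs
    have hψcont : Continuous ψ := hψ.continuous
    have hψi : Integrable ψ := hψcont.integrable_of_hasCompactSupport hψc
    -- This test function has derivative `ψ(t) - ψ(t - h)`. A translation moves the difference onto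
    -- `U`, and `integral_window_smul` moves the window integral onto `G`.
    set φ : ℝ → ℝ := fun t => ∫ s in (t - h)..t, ψ s with hφdef
    have hder : ∀ t, HasDerivAt φ (ψ t - ψ (t - h)) t := by
      intro t
      have hP : ∀ x, HasDerivAt (fun t => ∫ s in (0:ℝ)..t, ψ s) (ψ x) x := fun x =>
        (hψcont.integral_hasStrictDerivAt 0 x).hasDerivAt
      have h2 : HasDerivAt (fun t => ∫ s in (0:ℝ)..(t - h), ψ s) (ψ (t - h)) t := by
        simpa [Function.comp_def] using (hP (t - h)).comp t ((hasDerivAt_id' t).sub_const h)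
      have e : φ = (fun t => ∫ s in (0:ℝ)..t, ψ s) - fun t => ∫ s in (0:ℝ)..(t - h), ψ s := by
        funext x
        exact (intervalIntegral.integral_interval_sub_left hψi.intervalIntegrable
          hψi.intervalIntegrable).symm
      rw [e]
      exact (hP t).sub h2
    have hderiv : deriv φ = fun t => ψ t - ψ (t - h) := funext fun t => (hder t).deriv
    have hφ : ContDiff ℝ ∞ φ := by
      rw [contDiff_infty_iff_deriv, hderiv]
      exact ⟨fun t => (hder t).differentiableAt, hψ.sub (hψ.comp (contDiff_id.sub contDiff_const))⟩
    obtain ⟨a, b, hab, hsub⟩ : ∃ a b, Function.support ψ ⊆ Icc a b ∧ Icc a (b + h) ⊆ Ioo 0 T := by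
      rcases (tsupport ψ).eq_empty_or_nonempty with he | hne
      -- For `ψ = 0` these values make both intervals empty.
      · exact ⟨1, -h, by simp [tsupport_eq_empty_iff.1 he], by simp⟩
      · refine ⟨sInf (tsupport ψ), sSup (tsupport ψ), fun x hx => ?_, fun x hx => ?_⟩
        · exact ⟨csInf_le hψc.isCompact.bddBelow (subset_tsupport _ hx),
            le_csSup hψc.isCompact.bddAbove (subset_tsupport _ hx)⟩
        · have h1 := (hψs (hψc.isCompact.sInf_mem hne)).1
          have h2 := (hψs (hψc.isCompact.sSup_mem hne)).2
          exact ⟨h1.trans_le hx.1, by linarith [hx.2]⟩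
    have hφs : Function.support φ ⊆ Icc a (b + h) := by
      intro t ht
      by_contra hn
      apply ht
      refine (intervalIntegral.integral_congr (g := fun _ => (0:ℝ)) fun s hs => ?_).trans (by simp)
      rw [uIcc_of_le (by linarith)] at hs
      by_contra hs0
      have := hab hs0
      exact hn ⟨this.1.trans hs.2, by linarith [this.2, hs.1]⟩
    have hφc : HasCompactSupport φ := HasCompactSupport.of_support_subset_isCompact isCompact_Icc hφs
    have hφt : tsupport φ ⊆ Ioo 0 T := (closure_minimal hφs isClosed_Icc).trans hsub
    have hkey := hW φ hφ hφc hφt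
    rw [hderiv, integral_window_smul hψi hG hh.le] at hkey
    have ib : ∀ {χ : ℝ → ℝ} {f : ℝ → X}, Continuous χ → HasCompactSupport χ →
        LocallyIntegrable f → Integrable fun t => χ t • f t := fun h1 h2 h3 =>
      h3.integrable_smul_left_of_hasCompactSupport h1 h2
    have i1 : Integrable fun t => ψ t • U t := ib hψcont hψc hU.locallyIntegrable
    have i2 : Integrable fun t => ψ t • U (t + h) := ib hψcont hψc hUh.locallyIntegrable
    have i3 : Integrable fun t => ψ t • ∫ s in t..(t + h), G s :=
      ib hψcont hψc hGc.locallyIntegrable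
    have i4 : Integrable fun t => ψ (t - h) • U t := by
      simpa using i2.comp_sub_right h
    have e4 : ∫ t, ψ (t - h) • U t = ∫ t, ψ t • U (t + h) := by
      have := integral_sub_right_eq_self (μ := volume) (fun t => ψ t • U (t + h)) h
      simpa using this
    simp_rw [sub_smul] at hkey
    rw [integral_sub i1 i4, e4] at hkey
    simp_rw [smul_sub]
    have e5 : ∫ t, (ψ t • U (t + h) - ψ t • U t - ψ t • ∫ s in t..(t + h), G s)
        = (∫ t, (ψ t • U (t + h) - ψ t • U t)) - ∫ t, ψ t • ∫ s in t..(t + h), G s :=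
      integral_sub (i2.sub i1) i3
    rw [e5, integral_sub i2 i1, ← neg_neg (∫ t, ψ t • ∫ s in t..(t + h), G s),
      ← hkey]
    abel

end

/-- If `u_t` and `d` are square integrable in time and the form `⟨u t, d s⟩` is symmetric in `t, s`
and nonnegative for `t = s`, then the energy `⟨u t, d t⟩` is bounded at suitable times `t → 0`. -/
lemma exists_initial_energy_bound {X : Type*} [NormedAddCommGroup X] [InnerProductSpace ℝ X]
    [CompleteSpace X] {T : ℝ} (hT : 0 < T) {u g d : ℝ → X} (hu : L2Time T u) (hg : L2Time T g)
    (hd : L2Time T d) (hw : IsWeakTimeDeriv T u g) {S : Set ℝ}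
    (hS : ∀ᵐ t ∂volume.restrict (Ioo 0 T), t ∈ S)
    (hsymm : ∀ t ∈ S, ∀ s ∈ S, inner ℝ (u t) (d s) = inner ℝ (u s) (d t))
    (hpos : ∀ t ∈ S, 0 ≤ inner ℝ (u t) (d t)) :
    ∃ C, ∀ h ∈ Ioo 0 (T / 2), ∀ P : ℝ → Prop, (∀ᵐ t ∂volume.restrict (Ioo 0 T), P t) →
      ∃ t ∈ Ioo 0 h, P t ∧ inner ℝ (u t) (d t) ≤ C := by
  -- The absolute value gives `0 ≤ E` everywhere, also at times outside `S`.
  set E : ℝ → ℝ := (Ioo 0 T).indicator fun t => |inner ℝ (u t) (d t)| with hEdef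
  set G : ℝ → ℝ := (Ioo 0 T).indicator fun t => ‖g t‖ ^ 2 / 2 with hGdef
  set D : ℝ → ℝ := (Ioo 0 T).indicator fun t => ‖d t‖ ^ 2 with hDdef
  have hinner : Integrable (fun t => inner ℝ (u t) (d t)) (volume.restrict (Ioo 0 T)) :=
    (MemLp.integrable_mul (p := 2) (q := 2) hu.norm hd.norm).mono' (hu.1.inner hd.1)
      (ae_of_all _ fun t => norm_inner_le_norm (u t) (d t))
  have hE : Integrable E := IntegrableOn.integrable_indicator hinner.abs measurableSet_Ioo
  have hG : Integrable G :=
    (IntegrableOn.integrable_indicator (hg.integrable_norm_pow (by norm_num) |>.div_const 2)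
      measurableSet_Ioo)
  have hD : Integrable D :=
    (IntegrableOn.integrable_indicator (hd.integrable_norm_pow (by norm_num)) measurableSet_Ioo)
  have hu1 : IntegrableOn u (Ioo 0 T) := hu.integrable (by norm_num)
  have hg1 : IntegrableOn g (Ioo 0 T) := hg.integrable (by norm_num)
  rw [ae_restrict_iff' measurableSet_Ioo] at hS
  obtain ⟨C, hC⟩ := exists_initial_average_bound (c := T / 2) hE hG hD
    (indicator_nonneg fun _ _ => abs_nonneg _) (indicator_nonneg fun _ _ => by positivity)
    (indicator_nonneg fun _ _ => by positivity) (half_pos hT) (by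
      intro h hh
      have hSh : ∀ᵐ t : ℝ, t + h ∈ Ioo 0 T → t + h ∈ S :=
        (measurePreserving_add_right volume h).quasiMeasurePreserving.ae hS
      filter_upwards [hS, hSh, ae_sub_eq_integral_of_isWeakTimeDeriv hu1 hg1 hw hh.1]
        with t h1 h2 h3 ht
      have hI : uIcc t (t + h) ⊆ Ioo 0 T := by
        rw [uIcc_of_le (by linarith [hh.1])]
        exact fun s hs => ⟨ht.1.trans_le hs.1, hs.2.trans_lt (by linarith [ht.2, hh.2])⟩
      have m1 : t ∈ Ioo 0 T := hI left_mem_uIcc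
      have m2 : t + h ∈ Ioo 0 T := hI right_mem_uIcc
      have s1 := h1 m1
      have s2 := h2 m2
      have h3 := h3 ⟨ht.1, by linarith [ht.2, hh.2]⟩
      have e3 : ∫ s in t..(t + h), G s = ∫ s in t..(t + h), ‖g s‖ ^ 2 / 2 :=
        intervalIntegral.integral_congr fun s hs => indicator_of_mem (hI hs) _
      simp only [hEdef, hDdef, indicator_of_mem m1, indicator_of_mem m2, abs_of_nonneg (hpos _ s1),
        abs_of_nonneg (hpos _ s2)]
      rw [e3]
      set y : X := d (t + h) + d t with hy
      have gi : IntervalIntegrable g volume t (t + h) := by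
        rw [intervalIntegrable_iff]
        exact hg1.mono_set (uIoc_subset_uIcc.trans hI)
      have gi2 : IntervalIntegrable (fun s => ‖g s‖ ^ 2 / 2) volume t (t + h) := by
        rw [intervalIntegrable_iff]
        exact IntegrableOn.mono_set (hg.integrable_norm_pow (by norm_num) |>.div_const 2)
          (uIoc_subset_uIcc.trans hI)
      have e4 : inner ℝ y (u (t + h) - u t) = ∫ s in t..(t + h), inner ℝ y (g s) := by
        rw [h3]
        exact ((innerSL ℝ y).intervalIntegral_comp_comm gi).symm
      -- The cross terms cancel by `hsymm`.
      have e5 : inner ℝ y (u (t + h) - u t)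
          = inner ℝ (u (t + h)) (d (t + h)) - inner ℝ (u t) (d t) := by
        have := hsymm t s1 (t + h) s2
        rw [real_inner_comm, hy, inner_sub_left, inner_add_right, inner_add_right]
        linarith
      -- Young's inequality; the halves are absorbed by the definition of `G` and by the
      -- parallelogram law in `e7`.
      have e6 : - ∫ s in t..(t + h), inner ℝ y (g s) ≤
          ∫ s in t..(t + h), (‖g s‖ ^ 2 / 2 + ‖y‖ ^ 2 / 2) := by
        rw [← intervalIntegral.integral_neg]
        have yi : IntervalIntegrable (fun s => inner ℝ y (g s)) volume t (t + h) := by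
          rw [intervalIntegrable_iff] at gi ⊢
          exact (innerSL ℝ y).integrable_comp gi
        refine intervalIntegral.integral_mono_on (by linarith [hh.1]) yi.neg
          (gi2.add intervalIntegrable_const) fun s _ => ?_
        have := real_inner_le_norm (-y) (g s)
        rw [inner_neg_left, norm_neg] at this
        nlinarith [sq_nonneg (‖y‖ - ‖g s‖)]
      rw [intervalIntegral.integral_add gi2 intervalIntegrable_const,
        intervalIntegral.integral_const, smul_eq_mul] at e6
      have e7 : ‖y‖ ^ 2 / 2 ≤ ‖d (t + h)‖ ^ 2 + ‖d t‖ ^ 2 := by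
        have := parallelogram_law_with_norm ℝ (d (t + h)) (d t)
        nlinarith [sq_nonneg ‖d (t + h) - d t‖]
      have e8 := mul_le_mul_of_nonneg_left e7 hh.1.le
      have e9 : (t + h - t) * (‖y‖ ^ 2 / 2) = h * (‖y‖ ^ 2 / 2) := by ring
      linarith)
  refine ⟨C, fun h hh P hP => ?_⟩
  rw [ae_restrict_iff' measurableSet_Ioo] at hP
  have hne : volume.restrict (Ioo 0 h) ≠ 0 := by
    rw [Ne, Measure.restrict_eq_zero, Real.volume_Ioo, ENNReal.ofReal_eq_zero]
    linarith [hh.1]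
  have hN : ∀ᵐ t ∂volume.restrict (Ioo 0 h), t ∈ Ioo 0 h ∧ (t ∈ Ioo 0 T → P t) := by
    filter_upwards [ae_restrict_mem measurableSet_Ioo, ae_restrict_of_ae hP] with t h1 h2
      using ⟨h1, h2⟩
  -- A function is at most its average somewhere outside any given null set, here the one where `P`
  -- fails.
  obtain ⟨t, htN, hle⟩ := exists_notMem_null_le_average hne hE.restrict (ae_iff.1 hN)
  obtain ⟨ht, htP⟩ : t ∈ Ioo 0 h ∧ (t ∈ Ioo 0 T → P t) := not_not.1 htN
  have m1 : t ∈ Ioo 0 T := ⟨ht.1, by linarith [ht.2, hh.2]⟩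
  refine ⟨t, ht, htP m1, ?_⟩
  have hCh := hC h hh
  rw [intervalIntegral.integral_of_le hh.1.le, integral_Ioc_eq_integral_Ioo] at hCh
  rw [setAverage_eq, Real.volume_real_Ioo_of_le hh.1.le, sub_zero, smul_eq_mul,
    hEdef, indicator_of_mem m1, ← hEdef] at hle
  calc inner ℝ (u t) (d t) ≤ _ := (le_abs_self _).trans hle
    _ ≤ h⁻¹ * (C * h) := mul_le_mul_of_nonneg_left hCh (inv_nonneg.2 hh.1.le)
    _ = C := by field_simp [hh.1.ne']

variable {Ω : Opens Plane}

/-! ### Duality between `H¹₀(Ω)` and `H(div, Ω)` -/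

/-- Orthogonality to `(φ, ∇φ)` reads `(p.snd, ∇φ) = -(p.fst, φ)`, so `p.fst` is the weak divergence
of `p.snd`. Orthogonality to the generators passes to their closed span. -/
lemma mem_H10_orthogonal_iff {p : WithLp 2 (L2 Ω × L2vec Ω)} :
    p ∈ (H10 Ω)ᗮ ↔ WithLp.toLp 2 (p.snd, p.fst) ∈ Hdiv Ω := by
  have key : ∀ φ : 𝓓(Ω, ℝ), inner ℝ p (WithLp.toLp 2 (testL2 φ, testGrad φ)) = 0 ↔
      inner ℝ p.snd (testGrad φ) = - inner ℝ p.fst (testL2 φ) := by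
    intro φ
    rw [WithLp.prod_inner_apply]
    change inner ℝ p.fst (testL2 φ) + inner ℝ p.snd (testGrad φ) = 0 ↔ _
    constructor <;> intro h <;> linarith
  constructor
  · intro h φ
    refine (key φ).1 ?_
    rw [real_inner_comm]
    exact h _ (Submodule.le_topologicalClosure _ (Submodule.subset_span ⟨φ, rfl⟩))
  · intro h
    have hle : H10 Ω ≤ (Submodule.span ℝ {p})ᗮ := by
      refine Submodule.topologicalClosure_minimal _ (Submodule.span_le.2 ?_)
        (Submodule.isClosed_orthogonal _)
      rintro _ ⟨φ, rfl⟩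
      exact Submodule.mem_orthogonal_singleton_iff_inner_right.2 ((key φ).2 (h φ))
    intro w hw
    exact Submodule.mem_orthogonal_singleton_iff_inner_left.1 (hle hw)

/-- Integration by parts: the normal trace of `v` is irrelevant against functions in `H¹₀(Ω)`. -/
lemma inner_Hdiv_grad (v : Hdiv Ω) (w : H10 Ω) :
    inner ℝ (Hdiv.fn Ω v) (H10.grad Ω w) = - inner ℝ (Hdiv.div Ω v) (H10.fn Ω w) := by
  have h : WithLp.toLp 2 (Hdiv.div Ω v, Hdiv.fn Ω v) ∈ (H10 Ω)ᗮ :=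
    mem_H10_orthogonal_iff.2 v.2
  have h2 := h w w.2
  rw [real_inner_comm, WithLp.prod_inner_apply] at h2
  change inner ℝ (Hdiv.div Ω v) (H10.fn Ω w) + inner ℝ (Hdiv.fn Ω v) (H10.grad Ω w) = 0 at h2
  linarith

lemma H10_closed : IsClosed (H10 Ω : Set (WithLp 2 (L2 Ω × L2vec Ω))) :=
  Submodule.isClosed_topologicalClosure _

instance : CompleteSpace (H10 Ω) := H10_closed.completeSpace_coe

/-- A function belongs to `H¹₀(Ω)`, with weak gradient `q`, as soon as it satisfies the Green
formula against all of `H(div, Ω)`. -/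
lemma mem_H10_of_forall_Hdiv {g : L2 Ω} {q : L2vec Ω}
    (h : ∀ v : Hdiv Ω, inner ℝ q (Hdiv.fn Ω v) + inner ℝ g (Hdiv.div Ω v) = 0) :
    WithLp.toLp 2 (g, q) ∈ H10 Ω := by
  rw [← Submodule.orthogonal_orthogonal (H10 Ω)]
  intro p hp
  have h2 := h ⟨_, mem_H10_orthogonal_iff.1 hp⟩
  change inner ℝ q p.snd + inner ℝ g p.fst = 0 at h2
  rw [real_inner_comm, WithLp.prod_inner_apply]
  change inner ℝ g p.fst + inner ℝ q p.snd = 0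
  linarith

/-- A function belongs to `H¹₀(Ω)` if `v ↦ (g, ∇ · v)` is bounded in the norm of `L²(Ω)²`. -/
lemma exists_H10_of_bound {g : L2 Ω} {C : ℝ}
    (h : ∀ v : Hdiv Ω, inner ℝ g (Hdiv.div Ω v) ≤ C * ‖Hdiv.fn Ω v‖) :
    ∃ w : H10 Ω, H10.fn Ω w = g := by
  have habs : ∀ v : Hdiv Ω, |inner ℝ g (Hdiv.div Ω v)| ≤ C * ‖Hdiv.fn Ω v‖ := by
    intro v
    refine abs_le.2 ⟨?_, h v⟩
    have := h (-v)
    rw [map_neg, map_neg, inner_neg_right, norm_neg] at this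
    linarith
  let L : Hdiv Ω →ₗ[ℝ] L2vec Ω := (Hdiv.fn Ω).toLinearMap
  let M : Hdiv Ω →ₗ[ℝ] ℝ := ((innerSL ℝ g).comp (Hdiv.div Ω)).toLinearMap
  -- By the bound, `(g, ∇·v)` depends only on the field `v`, so `F` below does not depend on the
  -- chosen preimages.
  have hker : ∀ v v', L v = L v' → M v = M v' := by
    intro v v' hv
    have h1 := habs (v - v')
    have h2 : Hdiv.fn Ω (v - v') = 0 := by rw [map_sub]; exact sub_eq_zero.2 hv
    rw [h2, norm_zero, mul_zero, map_sub, inner_sub_right] at h1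
    exact sub_eq_zero.1 (abs_nonpos_iff.1 h1)
  let F : LinearMap.range L →ₗ[ℝ] ℝ :=
    { toFun := fun y => M y.2.choose
      map_add' := fun y y' => by
        rw [← map_add]
        refine hker _ _ ?_
        rw [(y + y').2.choose_spec, map_add, y.2.choose_spec, y'.2.choose_spec]
        rfl
      map_smul' := fun c y => by
        rw [RingHom.id_apply, ← map_smul]
        refine hker _ _ ?_
        rw [(c • y).2.choose_spec, map_smul, y.2.choose_spec]
        rfl }
  have hF : ∀ y, ‖F y‖ ≤ C * ‖y‖ := by
    intro y
    have h1 := habs y.2.choose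
    have h2 : Hdiv.fn Ω y.2.choose = y := y.2.choose_spec
    rw [h2] at h1
    exact h1
  -- Hahn–Banach extends `F` to all of `L²(Ω)²`. If `q` represents the extension, `-q` is the weak
  -- gradient of `g`.
  obtain ⟨Φ, hΦ, -⟩ := exists_extension_norm_eq (LinearMap.range L) (F.mkContinuous C hF)
  set q := (InnerProductSpace.toDual ℝ (L2vec Ω)).symm Φ with hq
  have hqv : ∀ v, inner ℝ q (Hdiv.fn Ω v) = inner ℝ g (Hdiv.div Ω v) := by
    intro v
    have h1 : inner ℝ q (Hdiv.fn Ω v) = Φ (Hdiv.fn Ω v) := by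
      rw [hq, InnerProductSpace.toDual_symm_apply]
    rw [h1]
    have h2 := hΦ ⟨Hdiv.fn Ω v, v, rfl⟩
    have hr : Hdiv.fn Ω v ∈ LinearMap.range L := ⟨v, rfl⟩
    exact h2.trans (hker _ _ hr.choose_spec)
  refine ⟨⟨WithLp.toLp 2 (g, -q), mem_H10_of_forall_Hdiv fun v => ?_⟩, rfl⟩
  rw [inner_neg_left, hqv v]
  ring

/-! ### The coefficient as an operator on `L²(Ω)²` -/

variable {A : Plane → Matrix (Fin 2) (Fin 2) ℝ}

lemma mulVec_mulVec (M N : Matrix (Fin 2) (Fin 2) ℝ) (ξ : Plane) :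
    mulVec M (mulVec N ξ) = mulVec (M * N) ξ :=
  congrArg (WithLp.toLp 2) (Matrix.mulVec_mulVec ξ.ofLp M N)

lemma mulVec_one (ξ : Plane) : mulVec 1 ξ = ξ := by
  simp [mulVec]

lemma mulVec_add (M : Matrix (Fin 2) (Fin 2) ℝ) (ξ η : Plane) :
    mulVec M (ξ + η) = mulVec M ξ + mulVec M η :=
  congrArg (WithLp.toLp 2) (Matrix.mulVec_add M ξ.ofLp η.ofLp)

lemma mulVec_smul (M : Matrix (Fin 2) (Fin 2) ℝ) (c : ℝ) (ξ : Plane) :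
    mulVec M (c • ξ) = c • mulVec M ξ :=
  congrArg (WithLp.toLp 2) (Matrix.mulVec_smul M c ξ.ofLp)

lemma inner_mulVec_of_isSymm {M : Matrix (Fin 2) (Fin 2) ℝ} (hM : M.IsSymm) (ξ η : Plane) :
    inner ℝ (mulVec M ξ) η = inner ℝ (mulVec M η) ξ := by
  have h := hM.apply 0 1
  simp [mulVec, PiLp.inner_apply, Fin.sum_univ_two, h]
  ring

lemma IsCoefficient.isUnit_det (hA : IsCoefficient Ω A) {x : Plane} (hx : x ∈ Ω) :
    IsUnit (A x).det := by
  obtain ⟨a, ha, h⟩ := hA.posDef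
  rw [← Matrix.isUnit_iff_isUnit_det, ← Matrix.mulVec_injective_iff_isUnit,
    ← Matrix.coe_mulVecLin, injective_iff_map_eq_zero]
  intro v hv
  have h1 := h x hx (WithLp.toLp 2 v)
  have h2 : mulVec (A x) (WithLp.toLp 2 v) = 0 := by
    simpa [mulVec] using hv
  rw [h2, inner_zero_left] at h1
  have h3 : ‖WithLp.toLp 2 v‖ ^ 2 = 0 :=
    le_antisymm (nonpos_of_mul_nonpos_right h1 ha) (by positivity)
  simpa using h3

lemma IsCoefficient.mulVec_mulVec_inv (hA : IsCoefficient Ω A) {x : Plane} (hx : x ∈ Ω)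
    (ξ : Plane) : mulVec (A x) (mulVec (A x)⁻¹ ξ) = ξ := by
  rw [mulVec_mulVec, Matrix.mul_nonsing_inv _ (hA.isUnit_det hx), mulVec_one]

lemma IsCoefficient.mulVec_inv_mulVec (hA : IsCoefficient Ω A) {x : Plane} (hx : x ∈ Ω)
    (ξ : Plane) : mulVec (A x)⁻¹ (mulVec (A x) ξ) = ξ := by
  rw [mulVec_mulVec, Matrix.nonsing_inv_mul _ (hA.isUnit_det hx), mulVec_one]

lemma IsCoefficient.aestronglyMeasurable_mulVec_inv (hA : IsCoefficient Ω A) {p : Plane → Plane}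
    (hp : AEStronglyMeasurable p (volume.restrict (Ω : Set Plane))) :
    AEStronglyMeasurable (fun x => mulVec (A x)⁻¹ (p x)) (volume.restrict (Ω : Set Plane)) := by
  have hent : ∀ i j, AEMeasurable (fun x => A x i j) (volume.restrict (Ω : Set Plane)) :=
    fun i j => (hA.smooth i j).continuousOn.aemeasurable Ω.isOpen.measurableSet
  have hpi : ∀ i, AEMeasurable (fun x => p x i) (volume.restrict (Ω : Set Plane)) := fun i =>
    ((EuclideanSpace.proj (𝕜 := ℝ) i).continuous.comp_aestronglyMeasurable hp).aemeasurable
  have hdet : AEMeasurable (fun x => (A x).det) (volume.restrict (Ω : Set Plane)) := by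
    simp_rw [Matrix.det_fin_two]
    exact ((hent 0 0).mul (hent 1 1)).sub ((hent 0 1).mul (hent 1 0))
  have hinv : ∀ i j, AEMeasurable (fun x => (A x)⁻¹ i j) (volume.restrict (Ω : Set Plane)) := by
    intro i j
    simp_rw [Matrix.inv_def, Ring.inverse_eq_inv', Matrix.adjugate_fin_two, Matrix.smul_apply,
      smul_eq_mul]
    refine hdet.inv.mul ?_
    fin_cases i <;> fin_cases j <;> simp
    · exact hent 1 1
    · exact hent 0 1
    · exact hent 1 0
    · exact hent 0 0
  refine AEMeasurable.aestronglyMeasurable ?_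
  refine (WithLp.measurable_toLp 2 (Fin 2 → ℝ)).comp_aemeasurable (aemeasurable_pi_lambda _ ?_)
  intro i
  simp only [Matrix.mulVec, dotProduct, Fin.sum_univ_two]
  exact ((hinv i 0).mul (hpi 0)).add ((hinv i 1).mul (hpi 1))

/-- Multiplication by `A⁻¹` is a bounded operator on `L²(Ω)²`. -/
lemma IsCoefficient.exists_invOp (hA : IsCoefficient Ω A) : ∃ B : L2vec Ω →L[ℝ] L2vec Ω,
    ∀ p : L2vec Ω, ∀ᵐ x ∂volume.restrict (Ω : Set Plane), B p x = mulVec (A x)⁻¹ (p x) := by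
  obtain ⟨a, ha, h⟩ := hA.posDef
  have hmem : ∀ᵐ x ∂volume.restrict (Ω : Set Plane), x ∈ Ω :=
    ae_restrict_mem Ω.isOpen.measurableSet
  have hbd : ∀ p : L2vec Ω, ∀ᵐ x ∂volume.restrict (Ω : Set Plane),
      ‖mulVec (A x)⁻¹ (p x)‖ ≤ a⁻¹ * ‖p x‖ := by
    intro p
    filter_upwards [hmem] with x hx
    -- The constant `a⁻¹` comes from `a‖η‖² ≤ (Aη, η) = (p, η) ≤ ‖p‖‖η‖`.
    set η := mulVec (A x)⁻¹ (p x) with hη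
    have h1 := h x hx η
    have h2 := real_inner_le_norm (mulVec (A x) η) η
    rw [hη, hA.mulVec_mulVec_inv hx, ← hη] at h1 h2
    rw [inv_mul_eq_div, le_div_iff₀ ha]
    rcases (norm_nonneg η).eq_or_lt with h0 | h0
    · rw [← h0, zero_mul]
      positivity
    · refine le_of_mul_le_mul_right ?_ h0
      nlinarith
  have hL : ∀ p : L2vec Ω, MemLp (fun x => mulVec (A x)⁻¹ (p x)) 2
      (volume.restrict (Ω : Set Plane)) := fun p =>
    (Lp.memLp p).of_le_mul (hA.aestronglyMeasurable_mulVec_inv (Lp.aestronglyMeasurable p)) (hbd p)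
  let B₀ : L2vec Ω →ₗ[ℝ] L2vec Ω :=
    { toFun := fun p => (hL p).toLp _
      map_add' := fun p q => by
        refine Lp.ext ?_
        filter_upwards [(hL (p + q)).coeFn_toLp, (hL p).coeFn_toLp, (hL q).coeFn_toLp,
          Lp.coeFn_add p q, Lp.coeFn_add ((hL p).toLp _) ((hL q).toLp _)] with x h1 h2 h3 h4 h5
        rw [h5, Pi.add_apply, h1, h2, h3, h4, Pi.add_apply, mulVec_add]
      map_smul' := fun c p => by
        refine Lp.ext ?_
        filter_upwards [(hL (c • p)).coeFn_toLp, (hL p).coeFn_toLp,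
          Lp.coeFn_smul c p, Lp.coeFn_smul c ((hL p).toLp _)] with x h1 h2 h4 h5
        rw [RingHom.id_apply, h5, Pi.smul_apply, h1, h2, h4, Pi.smul_apply, mulVec_smul] }
  refine ⟨B₀.mkContinuous a⁻¹ fun p => ?_, fun p => (hL p).coeFn_toLp⟩
  refine Lp.norm_le_mul_norm_of_ae_le_mul ?_
  filter_upwards [(hL p).coeFn_toLp, hbd p] with x h1 h2
  exact (congrArg norm h1).trans_le h2

lemma weightedInner_inv_eq {B : L2vec Ω →L[ℝ] L2vec Ω}
    (hB : ∀ p : L2vec Ω, ∀ᵐ x ∂volume.restrict (Ω : Set Plane), B p x = mulVec (A x)⁻¹ (p x))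
    (p q : L2vec Ω) : weightedInner (fun x => (A x)⁻¹) p q = inner ℝ (B p) q := by
  rw [L2.inner_def, weightedInner]
  refine integral_congr_ae ?_
  filter_upwards [hB p] with x hx
  rw [hx]

lemma IsCoefficient.inner_invOp_comm (hA : IsCoefficient Ω A) {B : L2vec Ω →L[ℝ] L2vec Ω}
    (hB : ∀ p : L2vec Ω, ∀ᵐ x ∂volume.restrict (Ω : Set Plane), B p x = mulVec (A x)⁻¹ (p x))
    (p q : L2vec Ω) : inner ℝ (B p) q = inner ℝ (B q) p := by
  rw [L2.inner_def, L2.inner_def]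
  refine integral_congr_ae ?_
  filter_upwards [hB p, hB q, ae_restrict_mem Ω.isOpen.measurableSet] with x h1 h2 hx
  rw [h1, h2]
  exact inner_mulVec_of_isSymm (by
    rw [Matrix.IsSymm, Matrix.transpose_nonsing_inv, hA.symm x hx]) _ _

/-- Positivity of `A` tested on `A⁻¹p`. The lower bound is in terms of `‖A⁻¹p‖`, the quantity that
controls `(u, ∇·v)` in the flux equation. -/
lemma IsCoefficient.inner_invOp_self (hA : IsCoefficient Ω A) {B : L2vec Ω →L[ℝ] L2vec Ω}
    (hB : ∀ p : L2vec Ω, ∀ᵐ x ∂volume.restrict (Ω : Set Plane), B p x = mulVec (A x)⁻¹ (p x)) :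
    ∃ a : ℝ, 0 < a ∧ ∀ p, a * ‖B p‖ ^ 2 ≤ inner ℝ (B p) p := by
  obtain ⟨a, ha, h⟩ := hA.posDef
  refine ⟨a, ha, fun p => ?_⟩
  rw [← real_inner_self_eq_norm_sq, L2.inner_def, L2.inner_def, ← integral_const_mul]
  refine integral_mono_ae ((L2.integrable_inner (𝕜 := ℝ) (B p) (B p)).const_mul a)
    (L2.integrable_inner (𝕜 := ℝ) (B p) p) ?_
  filter_upwards [hB p, ae_restrict_mem Ω.isOpen.measurableSet] with x h1 hx
  have h2 := h x hx (B p x)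
  rw [real_inner_self_eq_norm_sq]
  refine h2.trans_eq ?_
  rw [h1, hA.mulVec_mulVec_inv hx, real_inner_comm]

lemma IsCoefficient.weightedInner_invOp (hA : IsCoefficient Ω A) {B : L2vec Ω →L[ℝ] L2vec Ω}
    (hB : ∀ p : L2vec Ω, ∀ᵐ x ∂volume.restrict (Ω : Set Plane), B p x = mulVec (A x)⁻¹ (p x))
    (p q : L2vec Ω) : weightedInner A (B p) q = inner ℝ p q := by
  rw [L2.inner_def, weightedInner]
  refine integral_congr_ae ?_
  filter_upwards [hB p, ae_restrict_mem Ω.isOpen.measurableSet] with x h1 hx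
  rw [h1, hA.mulVec_mulVec_inv hx]

/-- `p = -A q` if and only if `q = -A⁻¹ p`. -/
lemma IsCoefficient.eq_neg_mulVec_iff (hA : IsCoefficient Ω A) {B : L2vec Ω →L[ℝ] L2vec Ω}
    (hB : ∀ p : L2vec Ω, ∀ᵐ x ∂volume.restrict (Ω : Set Plane), B p x = mulVec (A x)⁻¹ (p x))
    (p q : L2vec Ω) :
    (∀ᵐ x ∂volume.restrict (Ω : Set Plane), p x = - mulVec (A x) (q x)) ↔ q = B (-p) := by
  have hmem : ∀ᵐ x ∂volume.restrict (Ω : Set Plane), x ∈ Ω :=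
    ae_restrict_mem Ω.isOpen.measurableSet
  constructor
  · intro h
    refine Lp.ext ?_
    filter_upwards [h, hB (-p), hmem, Lp.coeFn_neg p] with x h1 h2 hx h3
    rw [h2, h3, Pi.neg_apply, h1, neg_neg, hA.mulVec_inv_mulVec hx]
  · rintro rfl
    filter_upwards [hB (-p), hmem, Lp.coeFn_neg p] with x h2 hx h3
    rw [h2, h3, hA.mulVec_mulVec_inv hx, Pi.neg_apply, neg_neg]

/-! ### The two formulations -/

lemma HasTimeRegularity.congr {T : ℝ} {u₀ u₁ : L2 Ω} {u v ut : ℝ → L2 Ω} {utt : ℝ → Hneg1 Ω}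
    (h : HasTimeRegularity T u₀ u₁ u ut utt)
    (huv : ∀ᵐ t ∂volume.restrict (Ioo 0 T), v t = u t) :
    HasTimeRegularity T u₀ u₁ v ut utt where
  memL2_u := h.memL2_u.ae_eq (Filter.EventuallyEq.symm huv)
  memL2_ut := h.memL2_ut
  memL2_utt := h.memL2_utt
  deriv_u := fun φ h1 h2 h3 => by
    rw [← h.deriv_u φ h1 h2 h3]
    refine integral_congr_ae ?_
    filter_upwards [huv] with t ht
    rw [ht]
  deriv_ut := h.deriv_ut
  initial_u := by
    obtain ⟨w, hw, hae, h0⟩ := h.initial_u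
    refine ⟨w, hw, ?_, h0⟩
    filter_upwards [huv, hae] with t h1 h2
    rw [h1, h2]
  initial_ut := h.initial_ut

lemma L2Time.clm_comp {X Y : Type*} [NormedAddCommGroup X] [NormedSpace ℝ X]
    [NormedAddCommGroup Y] [NormedSpace ℝ Y] {T : ℝ} {u : ℝ → X} (hu : L2Time T u)
    (L : X →L[ℝ] Y) : L2Time T fun t => L (u t) :=
  L.comp_memLp' hu

/-- A flux equation `(A⁻¹ p, v) = (g, ∇ · v)` for all `v ∈ H(div, Ω)` says that `g ∈ H¹₀(Ω)` with
`∇g = -A⁻¹ p`. -/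
lemma toLp_mem_H10_of_flux {B : L2vec Ω →L[ℝ] L2vec Ω} {g : L2 Ω} {p : L2vec Ω}
    (h : ∀ v : Hdiv Ω, inner ℝ (B p) (Hdiv.fn Ω v) - inner ℝ g (Hdiv.div Ω v) = 0) :
    WithLp.toLp 2 (g, B (-p)) ∈ H10 Ω := by
  refine mem_H10_of_forall_Hdiv fun v => ?_
  have := h v
  rw [map_neg, inner_neg_left]
  linarith

/-- The initial value of a function satisfying the flux equation at almost every time, and whose
time derivative is square integrable, belongs to `H¹₀(Ω)`. -/
lemma initialValue_mem_H10 (hA : IsCoefficient Ω A) {B : L2vec Ω →L[ℝ] L2vec Ω}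
    (hB : ∀ p : L2vec Ω, ∀ᵐ x ∂volume.restrict (Ω : Set Plane), B p x = mulVec (A x)⁻¹ (p x))
    {T : ℝ} (hT : 0 < T) {u ut : ℝ → L2 Ω} {u₀ : L2 Ω} {σ : ℝ → Hdiv Ω} (hu : L2Time T u)
    (hut : L2Time T ut) (hσ : L2Time T σ) (hd : IsWeakTimeDeriv T u ut)
    (h0 : HasInitialValue T u u₀)
    (h : ∀ᵐ t ∂volume.restrict (Ioo 0 T), ∀ v : Hdiv Ω,
      inner ℝ (B (Hdiv.fn Ω (σ t))) (Hdiv.fn Ω v) - inner ℝ (u t) (Hdiv.div Ω v) = 0) :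
    ∃ w : H10 Ω, H10.fn Ω w = u₀ := by
  obtain ⟨a, ha, hcoer⟩ := hA.inner_invOp_self hB
  set S : Set ℝ := {t | ∀ v : Hdiv Ω,
    inner ℝ (B (Hdiv.fn Ω (σ t))) (Hdiv.fn Ω v) - inner ℝ (u t) (Hdiv.div Ω v) = 0}
  have hval : ∀ t ∈ S, ∀ v : Hdiv Ω,
      inner ℝ (u t) (Hdiv.div Ω v) = inner ℝ (B (Hdiv.fn Ω (σ t))) (Hdiv.fn Ω v) :=
    fun t ht v => (sub_eq_zero.1 (ht v)).symm
  obtain ⟨C, hC⟩ := exists_initial_energy_bound hT hu hut (hσ.clm_comp (Hdiv.div Ω)) hd (S := S) h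
    (fun t ht s hs => by rw [hval t ht, hval s hs, hA.inner_invOp_comm hB])
    (fun t ht => by
      rw [hval t ht]
      exact le_trans (by positivity) (hcoer _))
  obtain ⟨w, hw, hwu, rfl⟩ := h0
  -- At the good times `a‖A⁻¹σ‖² ≤ (A⁻¹σ, σ) ≤ C`, so `‖A⁻¹σ‖ ≤ √(C / a)`.
  refine exists_H10_of_bound (C := √(C / a)) fun v => ?_
  have hcont : ContinuousWithinAt (fun t => inner ℝ (w t) (Hdiv.div Ω v)) (Ioi 0) 0 := by
    have h1 : ContinuousWithinAt w (Icc 0 T) 0 := hw 0 ⟨le_rfl, hT.le⟩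
    have h2 : ContinuousWithinAt w (Ioi 0) 0 :=
      (h1.mono Ioo_subset_Icc_self).mono_of_mem_nhdsWithin (Ioo_mem_nhdsGT hT)
    exact h2.inner continuousWithinAt_const
  -- The energy bound is known only at some times in each interval `(0, h)`; by continuity this
  -- suffices for the limit.
  refine le_of_tendsto_of_frequently hcont ?_
  rw [Filter.frequently_iff]
  intro U hU
  obtain ⟨ε, hε, hεU⟩ := mem_nhdsGT_iff_exists_Ioo_subset.1 hU
  have hε : 0 < ε := hε
  have hm : min ε (T / 4) ∈ Ioo 0 (T / 2) :=
    ⟨lt_min hε (by linarith), (min_le_right _ _).trans_lt (by linarith)⟩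
  obtain ⟨t, ht, ⟨htS, htw⟩, hE⟩ := hC _ hm (fun t => t ∈ S ∧ u t = w t) (h.and hwu)
  refine ⟨t, hεU ⟨ht.1, ht.2.trans_le (min_le_left _ _)⟩, ?_⟩
  rw [hval t htS] at hE
  rw [← htw, hval t htS]
  refine (real_inner_le_norm _ _).trans (mul_le_mul_of_nonneg_right ?_ (norm_nonneg _))
  refine Real.le_sqrt_of_sq_le ?_
  rw [le_div_iff₀ ha, mul_comm]
  exact (hcoer _).trans hE

end MixedWave

open MixedWave in
theorem theorem2p1 (Ω : TopologicalSpace.Opens MixedWave.Plane)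
    (hΩ : MixedWave.IsPolygonalDomain Ω)
    (T : ℝ) (hT : 0 < T)
    (A : MixedWave.Plane → Matrix (Fin 2) (Fin 2) ℝ) (hA : MixedWave.IsCoefficient Ω A)
    (f : ℝ → MixedWave.L2 Ω) (hf : MixedWave.L2Time T f)
    (u₀ u₁ : MixedWave.L2 Ω)
    (u : ℝ → MixedWave.L2 Ω) (hu : MixedWave.L2Time T u)
    (σ : ℝ → MixedWave.Hdiv Ω) (hσ : MixedWave.L2Time T σ) :
    MixedWave.IsMixedSolution T A f u₀ u₁ u σ ↔
      (∃ w : MixedWave.H10 Ω, MixedWave.H10.fn Ω w = u₀) ∧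
      ∃ z : ℝ → MixedWave.H10 Ω,
        (∀ᵐ t ∂volume.restrict (Ioo 0 T), MixedWave.H10.fn Ω (z t) = u t) ∧
        MixedWave.IsPrimalSolution T A f u₀ u₁ z ∧
        ∀ᵐ t ∂volume.restrict (Ioo 0 T), ∀ᵐ x ∂volume.restrict (Ω : Set MixedWave.Plane),
          MixedWave.Hdiv.fn Ω (σ t) x =
            - MixedWave.mulVec (A x) (MixedWave.H10.grad Ω (z t) x) := by
  obtain ⟨B, hB⟩ := hA.exists_invOp
  constructor
  · rintro ⟨-, ut, utt, hreg, hflux, hwave⟩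
    simp_rw [weightedInner_inv_eq hB] at hflux
    refine ⟨initialValue_mem_H10 hA hB hT hu hreg.memL2_ut hσ hreg.deriv_u hreg.initial_u hflux, ?_⟩
    set p : ℝ → WithLp 2 (L2 Ω × L2vec Ω) := fun t => WithLp.toLp 2 (u t, B (-Hdiv.fn Ω (σ t)))
    have hp : L2Time T p := by
      have h1 : L2Time T fun t => B (-Hdiv.fn Ω (σ t)) := hσ.clm_comp (B.comp (-Hdiv.fn Ω))
      have h2 := (hu.clm_comp (ContinuousLinearMap.inl ℝ (L2 Ω) (L2vec Ω))).add
        (h1.clm_comp (ContinuousLinearMap.inr ℝ (L2 Ω) (L2vec Ω)))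
      have h3 := L2Time.clm_comp h2
        (WithLp.prodContinuousLinearEquiv 2 ℝ (L2 Ω) (L2vec Ω)).symm.toContinuousLinearMap
      refine h3.ae_eq (ae_of_all _ fun t => ?_)
      simp [p]
    -- The pair `p t` lies in `H10 Ω` only for almost every `t`. Projecting defines `z` at every
    -- time, and continuity of the projection gives square integrability.
    set z : ℝ → H10 Ω := fun t => (H10 Ω).orthogonalProjectionOnto (p t)
    have hzp : ∀ᵐ t ∂volume.restrict (Ioo 0 T), (z t : WithLp 2 (L2 Ω × L2vec Ω)) = p t := by
      filter_upwards [hflux] with t ht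
      exact Submodule.starProjection_eq_self_iff.2 (toLp_mem_H10_of_flux ht)
    have hzu : ∀ᵐ t ∂volume.restrict (Ioo 0 T), H10.fn Ω (z t) = u t := by
      filter_upwards [hzp] with t ht
      exact congrArg WithLp.fst ht
    have hgrad : ∀ᵐ t ∂volume.restrict (Ioo 0 T), H10.grad Ω (z t) = B (-Hdiv.fn Ω (σ t)) := by
      filter_upwards [hzp] with t ht
      exact congrArg WithLp.snd ht
    refine ⟨z, hzu, ⟨hp.clm_comp (H10 Ω).orthogonalProjectionOnto, ut, utt, hreg.congr hzu, ?_⟩, ?_⟩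
    · filter_upwards [hgrad, hwave] with t ht hℓ w
      obtain ⟨ℓ, hext, heq⟩ := hℓ
      -- `(A∇u, ∇w) = -(σ, ∇w) = (∇·σ, w)`, and `ℓ` agrees with `u_tt` on `H¹₀`.
      rw [ht, hA.weightedInner_invOp hB, inner_neg_left, inner_Hdiv_grad, ← hext, ← heq]
      ring
    · filter_upwards [hgrad] with t ht
      exact (hA.eq_neg_mulVec_iff hB _ _).2 ht
  · rintro ⟨-, z, hzu, ⟨hz, ut, utt, hreg, heq⟩, hσz⟩
    have hgrad : ∀ᵐ t ∂volume.restrict (Ioo 0 T), H10.grad Ω (z t) = B (-Hdiv.fn Ω (σ t)) := by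
      filter_upwards [hσz] with t ht
      exact (hA.eq_neg_mulVec_iff hB _ _).1 ht
    refine ⟨hσ, ut, utt, hreg.congr ?_, ?_, ?_⟩
    · filter_upwards [hzu] with t ht using ht.symm
    · filter_upwards [hzu, hgrad] with t h1 h2 v
      -- With `∇u = -A⁻¹σ`, Green's formula is the flux equation.
      have h3 := inner_Hdiv_grad v (z t)
      rw [h2, map_neg, inner_neg_right, h1] at h3
      rw [weightedInner_inv_eq hB, real_inner_comm, real_inner_comm _ (u t)]
      linarith
    · filter_upwards [hgrad, heq] with t h1 h2
      -- The mixed wave equation leaves no other choice of `ℓ`; Green's formula shows that it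
      -- extends `u_tt`.
      refine ⟨innerSL ℝ (f t - Hdiv.div Ω (σ t)), fun w => ?_, fun w => ?_⟩
      · have h3 := h2 w
        rw [h1, hA.weightedInner_invOp hB, inner_neg_left, inner_Hdiv_grad] at h3
        rw [innerSL_apply_apply, inner_sub_left]
        linarith
      · rw [innerSL_apply_apply, inner_sub_left]
        ring
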